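/- For $\tau$ in the upper half-plane $\mathbb{H}$ put $q=e^{2\pi i\tau}$, let $\eta(\tau)=q^{1/24}\prod_{j\ge 1}(1-q^j)$ with $q^{1/24}=e^{2\pi i\tau/24}$ be the Dedekind eta function, and write $\eta_\ell=\eta(\ell\tau)$. Define $$u=\left(\frac{\eta_1\eta_{20}}{\eta_4\eta_5}\right)^2,\qquad v=\left(\frac{\eta_2\eta_5\eta_{20}}{\eta_1\eta_4\eta_{10}}\right)^2,\qquad z=\eta_2^2\,\eta_{10}^2,\qquad Z=\left(\sum_{m=-\infty}^{\infty}\sum_{n=-\infty}^{\infty}q^{m^2+5n^2}\right)^2,$$ and $X=z/Z$. Then for every $\tau\in\mathbb{H}$ the denominators $Z$, $(1+u)^2$ and $(1+v)(1+5v)$ are nonzero, and $$X=\frac{u}{(1+u)^2}=\frac{v}{(1+v)(1+5v)}.$$ -/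

import Mathlib

open UpperHalfPlane hiding I

namespace LevelTwenty

/-- `η_ℓ(τ) = η(ℓτ)`, where `η(τ) = q^{1/24} ∏_{j ≥ 1} (1 - q^j)`, `q = e^{2πiτ}`, is the
Dedekind eta function (with `q^{1/24} = e^{2πiτ/24}`). -/
noncomputable def etaScaled (l : ℕ) (τ : ℍ) : ℂ :=
  ModularForm.eta ((l : ℂ) * (τ : ℂ))

/-- The nome `q = e^{2πiτ}`. -/
noncomputable def nome (τ : ℍ) : ℂ :=
  Complex.exp (2 * (Real.pi : ℂ) * Complex.I * (τ : ℂ))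

/-- `u = (η_1 η_20 / (η_4 η_5))^2`. -/
noncomputable def u (τ : ℍ) : ℂ :=
  ((etaScaled 1 τ * etaScaled 20 τ) / (etaScaled 4 τ * etaScaled 5 τ)) ^ 2

/-- `v = (η_2 η_5 η_20 / (η_1 η_4 η_10))^2`. -/
noncomputable def v (τ : ℍ) : ℂ :=
  ((etaScaled 2 τ * etaScaled 5 τ * etaScaled 20 τ) /
    (etaScaled 1 τ * etaScaled 4 τ * etaScaled 10 τ)) ^ 2

/-- `z = η_2^2 η_10^2`. -/
noncomputable def z (τ : ℍ) : ℂ :=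
  etaScaled 2 τ ^ 2 * etaScaled 10 τ ^ 2

/-- `Z = (∑_{m ∈ ℤ} ∑_{n ∈ ℤ} q^{m^2 + 5 n^2})^2`. -/
noncomputable def Z (τ : ℍ) : ℂ :=
  (∑' m : ℤ, ∑' n : ℤ, nome τ ^ (m ^ 2 + 5 * n ^ 2)) ^ 2

/-- `X = z / Z`. -/
noncomputable def X (τ : ℍ) : ℂ :=
  z τ / Z τ

end LevelTwenty

open Filter Topology

namespace LevelTwenty

/-! Each of `Z`, `1 + u`, `1 + v` and `1 + 5v` is a single eta quotient. As `η` has no zeros, the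
nonvanishing claims are immediate, and both formulas for `X` reduce to cancelling monomials in the
`η_ℓ`.

For `Z`, the double sum factors as `φ(q) φ(q⁵)`, and the Jacobi triple product turns each `φ` into
an eta quotient. The other three quantities rest on two theta identities, with `E(q) = ∏ (1 - q^n)`.
For `1 + u`: `ψ(q²) φ(q⁵) - q φ(q) ψ(q¹⁰) = E(q) E(q⁵)`, from splitting a signed sum over `a² + 5b²`
by `a + b` modulo 6 (`thetaSeries_weight_one_identity`). For `1 + v`: `ψ²(q) - q ψ²(q⁵) = f(q, q⁴)
f(q², q³)`, from splitting a sum of two odd squares modulo 5 (`euler_level_ten_identity`). Replacing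
`q` by `-q` raises both to level 20. The quotient for `1 + 5v` is the image of the one for `1 + v`
under `τ ↦ -1/(20τ)`. -/

lemma summable_zpow_mul_zpow_sq {q z : ℂ} (hq0 : q ≠ 0) (hq : ‖q‖ < 1) (hz : z ≠ 0) :
    Summable fun n : ℤ ↦ z ^ n * q ^ (n ^ 2) := by
  have hπ : (Real.pi : ℂ) ≠ 0 := by exact_mod_cast Real.pi_ne_zero
  set τ : ℂ := Complex.log q / (Real.pi * Complex.I) with hτ
  set w : ℂ := Complex.log z / (2 * Real.pi * Complex.I) with hw
  have hτim : 0 < τ.im := by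
    have : τ = ((1 / Real.pi : ℝ) : ℂ) * (-Complex.I * Complex.log q) := by
      rw [hτ]; push_cast; field_simp; rw [Complex.I_sq]; ring
    rw [this, Complex.im_ofReal_mul]
    simp only [neg_mul, Complex.neg_im, Complex.I_mul_im, Complex.log_re]
    have := Real.log_neg (norm_pos_iff.2 hq0) hq
    have := Real.pi_pos
    exact mul_pos (by positivity) (by linarith)
  refine ((summable_jacobiTheta₂_term_iff w τ).2 hτim).congr fun n ↦ ?_
  have hI := Complex.I_ne_zero
  have h1 : 2 * Real.pi * Complex.I * n * w = n * Complex.log z := by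
    rw [hw]; field_simp
  have h2 : Real.pi * Complex.I * n ^ 2 * τ = (n ^ 2 : ℤ) * Complex.log q := by
    rw [hτ]; push_cast; field_simp
  rw [jacobiTheta₂_term, Complex.exp_add, h1, h2, Complex.exp_int_mul, Complex.exp_int_mul,
    Complex.exp_log hz, Complex.exp_log hq0]

lemma norm_pow_lt_one {q : ℂ} (hq : ‖q‖ < 1) {m : ℕ} (hm : m ≠ 0) : ‖q ^ m‖ < 1 := by
  rw [norm_pow]; exact pow_lt_one₀ (norm_nonneg _) hq hm

/-! ### Gaussian binomials and the finite triple product. -/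

/-- The reciprocal `1 / ∏_{k < m} (1 - p^{k+1})`, extended by zero to negative `m`. -/
noncomputable def invPoch (p : ℂ) (m : ℤ) : ℂ :=
  if m < 0 then 0 else (∏ k ∈ Finset.range m.toNat, (1 - p ^ (k + 1)))⁻¹

lemma one_sub_pow_succ_ne_zero {p : ℂ} (hp : ‖p‖ < 1) (k : ℕ) : 1 - p ^ (k + 1) ≠ 0 := by
  intro h
  have h1 : ‖p‖ ^ (k + 1) = 1 := by rw [← norm_pow, ← sub_eq_zero.1 h, norm_one]
  exact absurd h1 (pow_lt_one₀ (norm_nonneg _) hp (by simp)).ne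

/-- At `m = 0` the factor `1 - p^m` vanishes, in agreement with the extension by zero, so the
recurrence needs no boundary cases. -/
lemma invPoch_sub_one {p : ℂ} (hp : ‖p‖ < 1) (m : ℤ) :
    invPoch p (m - 1) = (1 - p ^ m) * invPoch p m := by
  rcases lt_trichotomy m 0 with h | rfl | h
  · simp [invPoch, h, show m - 1 < 0 by omega]
  · simp [invPoch]
  · obtain ⟨k, rfl⟩ : ∃ k : ℕ, m = k + 1 := ⟨(m - 1).toNat, by omega⟩
    have h2 : ¬ ((k : ℤ) + 1 < 0) := by omega
    have h3 := one_sub_pow_succ_ne_zero hp k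
    have h4 : ((k : ℤ) + 1).toNat = k + 1 := by omega
    have h5 : p ^ ((k : ℤ) + 1) = p ^ (k + 1) := by exact_mod_cast zpow_natCast p (k + 1)
    simp only [invPoch, add_sub_cancel_right, if_neg h2, h4, Finset.prod_range_succ, h5]
    simp only [Int.toNat_natCast, mul_inv]
    rw [if_neg (by omega)]
    field_simp

/-- The central Gaussian binomial `[2N, N+n]_p`. -/
noncomputable def centralGauss (p : ℂ) (N : ℕ) (n : ℤ) : ℂ :=
  (∏ k ∈ Finset.range (2 * N), (1 - p ^ (k + 1))) * invPoch p (N + n) * invPoch p (N - n)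

lemma centralGauss_zero (p : ℂ) (n : ℤ) : centralGauss p 0 n = if n = 0 then 1 else 0 := by
  rcases lt_trichotomy n 0 with h | rfl | h
  · simp [centralGauss, invPoch, h, h.ne]
  · simp [centralGauss, invPoch]
  · simp [centralGauss, invPoch, h, h.ne']

/-- This is the coefficient of `z^n` when the finite product is multiplied by its next factor `(1 +
zQ)(1 + z⁻¹Q) = 1 + Q² + Qz + Qz⁻¹`, where `Q = q^(2N+1)`. -/
lemma centralGauss_succ {q : ℂ} (hq0 : q ≠ 0) (hq : ‖q‖ < 1) (N : ℕ) (n : ℤ) :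
    q ^ n ^ 2 * centralGauss (q ^ 2) (N + 1) n =
      (1 + q ^ (4 * N + 2)) * (q ^ n ^ 2 * centralGauss (q ^ 2) N n) +
      q ^ (2 * N + 1) * (q ^ (n - 1) ^ 2 * centralGauss (q ^ 2) N (n - 1)) +
      q ^ (2 * N + 1) * (q ^ (n + 1) ^ 2 * centralGauss (q ^ 2) N (n + 1)) := by
  have hp : ‖q ^ 2‖ < 1 := norm_pow_lt_one hq two_ne_zero
  have hp0 : q ^ 2 ≠ 0 := pow_ne_zero _ hq0
  have e1 := invPoch_sub_one hp (N + 1 + n)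
  have e2 := invPoch_sub_one hp (N + 1 - n)
  have e3 := invPoch_sub_one hp (N + n)
  have e4 := invPoch_sub_one hp (N - n)
  rw [show (N : ℤ) + 1 + n - 1 = N + n by ring] at e1
  rw [show (N : ℤ) + 1 - n - 1 = N - n by ring] at e2
  have g0 : q ^ (n - 1) ^ 2 = q ^ n ^ 2 * (q * ((q ^ n) ^ 2)⁻¹) := by
    rw [← zpow_natCast (q ^ n) 2, ← zpow_mul, ← zpow_neg, ← zpow_one_add₀ hq0, ← zpow_add₀ hq0]
    congr 1; push_cast; ring
  have g1 : q ^ (n + 1) ^ 2 = q ^ n ^ 2 * (q * (q ^ n) ^ 2) := by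
    rw [← zpow_natCast (q ^ n) 2, ← zpow_mul, ← zpow_one_add₀ hq0, ← zpow_add₀ hq0]
    congr 1; push_cast; ring
  have hn : q ^ n ≠ 0 := zpow_ne_zero _ hq0
  have hc : (q ^ 2) ^ n = (q ^ n) ^ 2 := by
    rw [← zpow_natCast, ← zpow_natCast, ← zpow_mul, ← zpow_mul, mul_comm]
  have k1 : (q ^ 2) ^ ((N : ℤ) + 1 + n) = q ^ (2 * N + 2) * (q ^ n) ^ 2 := by
    rw [zpow_add₀ hp0, zpow_add_one₀ hp0, zpow_natCast, hc]; ring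
  have k2 : (q ^ 2) ^ ((N : ℤ) + 1 - n) = q ^ (2 * N + 2) * ((q ^ n) ^ 2)⁻¹ := by
    rw [zpow_sub₀ hp0, zpow_add_one₀ hp0, zpow_natCast, hc]; ring
  have k3 : (q ^ 2) ^ ((N : ℤ) + n) = q ^ (2 * N) * (q ^ n) ^ 2 := by
    rw [zpow_add₀ hp0, zpow_natCast, hc]; ring
  have k4 : (q ^ 2) ^ ((N : ℤ) - n) = q ^ (2 * N) * ((q ^ n) ^ 2)⁻¹ := by
    rw [zpow_sub₀ hp0, zpow_natCast, hc]; ring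
  rw [g0, g1]
  simp only [centralGauss]
  rw [show (N : ℤ) + (n - 1) = N + n - 1 by ring, show (N : ℤ) - (n + 1) = N - n - 1 by ring,
    show (N : ℤ) - (n - 1) = N + 1 - n by ring, show (N : ℤ) + (n + 1) = N + 1 + n by ring,
    e3, e4, e1, e2, show 2 * (N + 1) = 2 * N + 1 + 1 by ring, Finset.prod_range_succ,
    Finset.prod_range_succ, k1, k2, k3, k4]
  push_cast
  field_simp
  ring

lemma hasSum_centralGauss {q z : ℂ} (hq0 : q ≠ 0) (hq : ‖q‖ < 1) (hz : z ≠ 0) (N : ℕ) :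
    HasSum (fun n : ℤ ↦ z ^ n * (q ^ n ^ 2 * centralGauss (q ^ 2) N n))
      (∏ k ∈ Finset.range N, ((1 + z * q ^ (2 * k + 1)) * (1 + z⁻¹ * q ^ (2 * k + 1)))) := by
  induction N with
  | zero =>
    convert! hasSum_ite_eq (0 : ℤ) (1 : ℂ) using 1
    ext n
    by_cases hn : n = 0 <;> simp [centralGauss_zero, hn]
  | succ N ih =>
    have h0 := ih.mul_left (1 + q ^ (4 * N + 2))
    have h1 := ((Equiv.subRight (1 : ℤ)).hasSum_iff.2 ih).mul_left (z * q ^ (2 * N + 1))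
    have h2 := ((Equiv.addRight (1 : ℤ)).hasSum_iff.2 ih).mul_left (z⁻¹ * q ^ (2 * N + 1))
    rw [Finset.prod_range_succ]
    convert! (h0.add h1).add h2 using 1
    · ext n
      simp only [Function.comp_apply, Equiv.subRight_apply, Equiv.coe_addRight]
      rw [centralGauss_succ hq0 hq, zpow_sub_one₀ hz, zpow_add_one₀ hz]
      field_simp
    · field_simp
      ring

/-! ### Euler products and the limit of the finite triple product. -/

/-- Euler's product `∏_{n ≥ 1} (1 - q^n)`. -/
noncomputable def euler (q : ℂ) : ℂ := ∏' n : ℕ, (1 - q ^ (n + 1))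

lemma tendsto_euler {q : ℂ} (hq : ‖q‖ < 1) :
    Tendsto (fun N ↦ ∏ k ∈ Finset.range N, (1 - q ^ (k + 1))) atTop (𝓝 (euler q)) :=
  (ModularForm.multipliable_one_sub_pow hq).tendsto_prod_tprod_nat

lemma euler_ne_zero {q : ℂ} (hq : ‖q‖ < 1) : euler q ≠ 0 := by
  simp only [euler, sub_eq_add_neg]
  refine tprod_one_add_ne_zero_of_summable (f := fun n : ℕ ↦ -q ^ (n + 1)) (fun i ↦ ?_) ?_
  · simpa [sub_eq_add_neg] using one_sub_pow_succ_ne_zero hq i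
  · simpa using (summable_nat_add_iff 1).mpr (summable_geometric_of_lt_one (norm_nonneg _) hq)

lemma tendsto_invPoch {p : ℂ} (hp : ‖p‖ < 1) :
    Tendsto (invPoch p) atTop (𝓝 (euler p)⁻¹) := by
  have h := ((tendsto_euler hp).inv₀ (euler_ne_zero hp)).comp (tendsto_atTop.2 fun b ↦ by
    filter_upwards [eventually_ge_atTop (b : ℤ)] with m hm; omega : Tendsto Int.toNat atTop atTop)
  refine h.congr' ?_
  filter_upwards [eventually_ge_atTop 0] with m hm
  simp [invPoch, hm.not_gt]

lemma tendsto_centralGauss {p : ℂ} (hp : ‖p‖ < 1) (n : ℤ) :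
    Tendsto (fun N ↦ centralGauss p N n) atTop (𝓝 (euler p)⁻¹) := by
  have h1 : Tendsto (fun N : ℕ ↦ (N : ℤ) + n) atTop atTop :=
    tendsto_atTop_add_const_right _ _ tendsto_natCast_atTop_atTop
  have h2 : Tendsto (fun N : ℕ ↦ (N : ℤ) - n) atTop atTop :=
    tendsto_atTop_add_const_right _ _ tendsto_natCast_atTop_atTop
  have h3 : Tendsto (fun N : ℕ ↦ 2 * N) atTop atTop :=
    tendsto_id.const_mul_atTop' (by norm_num)
  have := (((tendsto_euler hp).comp h3).mul ((tendsto_invPoch hp).comp h1)).mul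
    ((tendsto_invPoch hp).comp h2)
  rwa [mul_inv_cancel₀ (euler_ne_zero hp), one_mul] at this

lemma exists_norm_invPoch_le {p : ℂ} (hp : ‖p‖ < 1) : ∃ C, ∀ m, ‖invPoch p m‖ ≤ C := by
  have h := ((tendsto_euler hp).inv₀ (euler_ne_zero hp)).norm.bddAbove_range
  obtain ⟨C, hC⟩ := h
  refine ⟨max C 0, fun m ↦ ?_⟩
  by_cases hm : m < 0
  · simp [invPoch, hm]
  · simp only [invPoch, if_neg hm]
    exact (hC ⟨m.toNat, rfl⟩).trans (le_max_left _ _)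

lemma exists_norm_centralGauss_le {p : ℂ} (hp : ‖p‖ < 1) :
    ∃ C, ∀ N n, ‖centralGauss p N n‖ ≤ C := by
  obtain ⟨C, hC⟩ := exists_norm_invPoch_le hp
  obtain ⟨D, hD⟩ := (tendsto_euler hp).norm.bddAbove_range
  refine ⟨D * C * C, fun N n ↦ ?_⟩
  have hD' : ‖∏ k ∈ Finset.range (2 * N), (1 - p ^ (k + 1))‖ ≤ D := hD ⟨2 * N, rfl⟩
  have hD0 := (norm_nonneg _).trans hD'
  have hC0 := (norm_nonneg _).trans (hC 0)
  rw [centralGauss, norm_mul, norm_mul]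
  gcongr
  · exact hC _
  · exact hC _

/-- The Jacobi triple product identity, as a limit of finite products. -/
theorem tendsto_jacobi_triple_product {q z : ℂ} (hq0 : q ≠ 0) (hq : ‖q‖ < 1) (hz : z ≠ 0) :
    Tendsto (fun N ↦ ∏ k ∈ Finset.range N, ((1 - (q ^ 2) ^ (k + 1)) *
      ((1 + z * q ^ (2 * k + 1)) * (1 + z⁻¹ * q ^ (2 * k + 1))))) atTop
      (𝓝 (∑' n : ℤ, z ^ n * q ^ n ^ 2)) := by
  have hp := norm_pow_lt_one hq two_ne_zero
  obtain ⟨C, hC⟩ := exists_norm_centralGauss_le hp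
  have hs := summable_zpow_mul_zpow_sq hq0 hq hz
  -- Tannery's theorem: the Gaussian binomials are bounded uniformly in `N` and `n`, and tend to `1
  -- / E(q²)`.
  have key := tendsto_tsum_of_dominated_convergence (𝓕 := atTop)
    (f := fun N n ↦ z ^ n * (q ^ n ^ 2 * centralGauss (q ^ 2) N n))
    (g := fun n : ℤ ↦ z ^ n * (q ^ n ^ 2 * (euler (q ^ 2))⁻¹))
    (bound := fun n ↦ ‖z ^ n * q ^ n ^ 2‖ * C) (hs.norm.mul_right C)
    (fun n ↦ ((tendsto_centralGauss hp n).const_mul _).const_mul _)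
    (Eventually.of_forall fun N n ↦ by
      rw [← mul_assoc, norm_mul]; gcongr; exact hC _ _)
  simp only [(hasSum_centralGauss hq0 hq hz _).tsum_eq] at key
  simp only [← mul_assoc, tsum_mul_right] at key
  have := (tendsto_euler hp).mul key
  rw [mul_left_comm, mul_inv_cancel₀ (euler_ne_zero hp), mul_one] at this
  refine this.congr fun N ↦ ?_
  simp only [← Finset.prod_mul_distrib]

/-! ### Product formulas for special theta series. -/

/-- The theta series `∑_{n ∈ ℤ} z^n q^{n²}`. -/
noncomputable def thetaSeries (z q : ℂ) : ℂ := ∑' n : ℤ, z ^ n * q ^ n ^ 2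

lemma prod_range_odd_mul_even (q : ℂ) (N : ℕ) :
    (∏ k ∈ Finset.range N, (1 - q ^ (2 * k + 1))) *
      ∏ k ∈ Finset.range N, (1 - (q ^ 2) ^ (k + 1)) =
      ∏ k ∈ Finset.range (2 * N), (1 - q ^ (k + 1)) := by
  induction N with
  | zero => simp
  | succ N ih =>
    rw [show 2 * (N + 1) = 2 * N + 1 + 1 by ring, Finset.prod_range_succ, Finset.prod_range_succ,
      Finset.prod_range_succ, Finset.prod_range_succ, ← ih]
    ring

lemma tendsto_const_mul_atTop_nat {m : ℕ} (hm : 0 < m) :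
    Tendsto (fun N : ℕ ↦ m * N) atTop atTop :=
  tendsto_id.const_mul_atTop' hm

lemma tendsto_prod_one_sub_odd {q : ℂ} (hq : ‖q‖ < 1) :
    Tendsto (fun N ↦ ∏ k ∈ Finset.range N, (1 - q ^ (2 * k + 1))) atTop
      (𝓝 (euler q / euler (q ^ 2))) := by
  have hq2 := norm_pow_lt_one hq two_ne_zero
  refine (((tendsto_euler hq).comp (tendsto_const_mul_atTop_nat two_pos)).div
    (tendsto_euler hq2) (euler_ne_zero hq2)).congr fun N ↦ ?_
  simp only [Pi.div_apply, Function.comp_apply, ← prod_range_odd_mul_even]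
  exact mul_div_cancel_right₀ _ (Finset.prod_ne_zero_iff.2 fun k _ ↦
    one_sub_pow_succ_ne_zero hq2 k)

lemma tendsto_prod_one_add_pow_succ {q : ℂ} (hq : ‖q‖ < 1) :
    Tendsto (fun N ↦ ∏ k ∈ Finset.range N, (1 + q ^ (k + 1))) atTop
      (𝓝 (euler (q ^ 2) / euler q)) := by
  refine ((tendsto_euler (norm_pow_lt_one hq two_ne_zero)).div
    (tendsto_euler hq) (euler_ne_zero hq)).congr fun N ↦ ?_
  simp only [Pi.div_apply]
  rw [div_eq_iff (Finset.prod_ne_zero_iff.2 fun k _ ↦ one_sub_pow_succ_ne_zero hq k),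
    ← Finset.prod_mul_distrib]
  exact Finset.prod_congr rfl fun k _ ↦ by ring

lemma tendsto_prod_one_add_pow {q : ℂ} (hq : ‖q‖ < 1) :
    Tendsto (fun N ↦ ∏ k ∈ Finset.range N, (1 + q ^ k)) atTop
      (𝓝 (2 * (euler (q ^ 2) / euler q))) := by
  rw [← tendsto_add_atTop_iff_nat 1]
  refine ((tendsto_prod_one_add_pow_succ hq).const_mul 2).congr fun N ↦ ?_
  rw [Finset.prod_range_succ']
  norm_num
  ring

/-- Over odd `m`, `(1 - q^m)(1 + q^m) = 1 - q^(2m)`, and each odd product is a quotient of Euler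
products. -/
lemma euler_neg_mul {q : ℂ} (hq : ‖q‖ < 1) :
    euler (-q) * euler q * euler (q ^ 4) = euler (q ^ 2) ^ 3 := by
  have h1 := tendsto_prod_one_sub_odd hq
  have h2 := tendsto_prod_one_sub_odd (q := -q) (by simpa using hq)
  have h3 := tendsto_prod_one_sub_odd (norm_pow_lt_one hq two_ne_zero)
  have h : euler q / euler (q ^ 2) * (euler (-q) / euler ((-q) ^ 2)) =
      euler (q ^ 2) / euler ((q ^ 2) ^ 2) := by
    refine tendsto_nhds_unique (h1.mul h2) (h3.congr fun N ↦ ?_)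
    rw [← Finset.prod_mul_distrib]
    refine Finset.prod_congr rfl fun k _ ↦ ?_
    rw [Odd.neg_pow ⟨k, rfl⟩]
    ring
  have n2 := euler_ne_zero (norm_pow_lt_one hq two_ne_zero)
  have n4 := euler_ne_zero (norm_pow_lt_one hq four_ne_zero)
  rw [neg_sq, ← pow_mul] at h
  field_simp at h
  linear_combination h

lemma thetaSeries_one {q : ℂ} (hq0 : q ≠ 0) (hq : ‖q‖ < 1) :
    thetaSeries 1 q = euler (-q) ^ 2 / euler (q ^ 2) := by
  have h1 := tendsto_prod_one_sub_odd (q := -q) (by simpa using hq)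
  have hq2 := norm_pow_lt_one hq two_ne_zero
  have n2 := euler_ne_zero hq2
  have h2 := (tendsto_euler hq2).mul (h1.mul h1)
  refine tendsto_nhds_unique (tendsto_jacobi_triple_product hq0 hq one_ne_zero) ?_
  convert! h2 using 1
  · ext N
    simp only [← Finset.prod_mul_distrib]
    refine Finset.prod_congr rfl fun k _ ↦ ?_
    rw [Odd.neg_pow ⟨k, rfl⟩]
    simp
  · rw [neg_sq]; congr 1; field_simp

/-- This is `2ψ(x²)`: for `z = x` the factors `1 + z⁻¹ x^(2k+1) = 1 + x^(2k)` start with a 2 at `k =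
0`. -/
lemma thetaSeries_self {x : ℂ} (hx0 : x ≠ 0) (hx : ‖x‖ < 1) :
    thetaSeries x x = 2 * euler (x ^ 4) ^ 2 / euler (x ^ 2) := by
  have hq2 := norm_pow_lt_one hx two_ne_zero
  have n2 := euler_ne_zero hq2
  have h2 := (tendsto_euler hq2).mul
    ((tendsto_prod_one_add_pow_succ hq2).mul (tendsto_prod_one_add_pow hq2))
  refine tendsto_nhds_unique (tendsto_jacobi_triple_product hx0 hx hx0) ?_
  convert! h2 using 1
  · ext N
    simp only [← Finset.prod_mul_distrib]
    refine Finset.prod_congr rfl fun k _ ↦ ?_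
    rw [show x⁻¹ * x ^ (2 * k + 1) = (x ^ 2) ^ k by rw [pow_succ', ← pow_mul]; field_simp]
    ring
  · rw [← pow_mul]; congr 1; field_simp

lemma prod_range_three_mul (f : ℕ → ℂ) (N : ℕ) : ∏ k ∈ Finset.range (3 * N), f k =
    ∏ k ∈ Finset.range N, f (3 * k) * f (3 * k + 1) * f (3 * k + 2) := by
  induction N with
  | zero => simp
  | succ N ih =>
    rw [show 3 * (N + 1) = 3 * N + 1 + 1 + 1 by ring, Finset.prod_range_succ, Finset.prod_range_succ,
      Finset.prod_range_succ, Finset.prod_range_succ, ← ih]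
    ring

lemma prod_range_five_mul (f : ℕ → ℂ) (N : ℕ) : ∏ k ∈ Finset.range (5 * N), f k =
    ∏ k ∈ Finset.range N,
      f (5 * k) * f (5 * k + 1) * f (5 * k + 2) * f (5 * k + 3) * f (5 * k + 4) := by
  induction N with
  | zero => simp
  | succ N ih =>
    rw [show 5 * (N + 1) = 5 * N + 1 + 1 + 1 + 1 + 1 by ring, Finset.prod_range_succ,
      Finset.prod_range_succ, Finset.prod_range_succ, Finset.prod_range_succ,
      Finset.prod_range_succ, Finset.prod_range_succ, ← ih]
    ring

/-- The pentagonal number theorem. -/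
lemma thetaSeries_neg_cube {x : ℂ} (hx0 : x ≠ 0) (hx : ‖x‖ < 1) :
    thetaSeries (-x) (x ^ 3) = euler (x ^ 2) := by
  have hq2 := norm_pow_lt_one hx two_ne_zero
  refine tendsto_nhds_unique (tendsto_jacobi_triple_product (pow_ne_zero 3 hx0)
    (norm_pow_lt_one hx three_ne_zero) (neg_ne_zero.2 hx0))
    (((tendsto_euler hq2).comp (tendsto_const_mul_atTop_nat three_pos)).congr fun N ↦ ?_)
  rw [Function.comp_apply, prod_range_three_mul]
  refine Finset.prod_congr rfl fun k _ ↦ ?_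
  rw [show (-x)⁻¹ * (x ^ 3) ^ (2 * k + 1) = - (x ^ 2) ^ (3 * k + 1) by
    rw [inv_neg]; field_simp; ring]
  ring

/-- This is `f(q, q⁴) f(q², q³)` with `q = x²`. The factors `1 + q^j` run over all `j` prime to 5;
supplying the multiples of 5 completes the product. -/
lemma thetaSeries_mul_thetaSeries_five {x : ℂ} (hx0 : x ≠ 0) (hx : ‖x‖ < 1) :
    thetaSeries (x ^ 3) (x ^ 5) * thetaSeries x (x ^ 5) =
      euler (x ^ 4) * euler (x ^ 10) ^ 3 / (euler (x ^ 2) * euler (x ^ 20)) := by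
  have h5 : x ^ 5 ≠ 0 := pow_ne_zero 5 hx0
  have h5' := norm_pow_lt_one hx (show 5 ≠ 0 by norm_num)
  have hq2 := norm_pow_lt_one hx two_ne_zero
  have hq10 := norm_pow_lt_one hx (show 10 ≠ 0 by norm_num)
  have n2 := euler_ne_zero hq2
  have n10 := euler_ne_zero hq10
  have n20 := euler_ne_zero (norm_pow_lt_one hx (show 20 ≠ 0 by norm_num))
  have key := ((tendsto_jacobi_triple_product h5 h5' (pow_ne_zero 3 hx0)).mul
    (tendsto_jacobi_triple_product h5 h5' hx0)).mul (tendsto_prod_one_add_pow_succ hq10)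
  have key2 := ((tendsto_euler hq10).mul (tendsto_euler hq10)).mul
    ((tendsto_prod_one_add_pow_succ hq2).comp (tendsto_const_mul_atTop_nat (m := 5) (by norm_num)))
  have := tendsto_nhds_unique key (key2.congr fun N ↦ ?_)
  · rw [← pow_mul, ← pow_mul] at this
    simp only [thetaSeries]
    field_simp at this ⊢
    linear_combination this
  · rw [Function.comp_apply, prod_range_five_mul]
    simp only [← Finset.prod_mul_distrib]
    refine Finset.prod_congr rfl fun k _ ↦ ?_
    rw [show x⁻¹ * (x ^ 5) ^ (2 * k + 1) = (x ^ 2) ^ (5 * k + 2) by field_simp; ring,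
      show (x ^ 3)⁻¹ * (x ^ 5) ^ (2 * k + 1) = (x ^ 2) ^ (5 * k + 1) by field_simp; ring]
    ring

/-! ### Rearranging double series. -/

lemma tsum_eq_sum_tsum_of_bijective {κ α β : Type*} [Fintype κ] {F : β → ℂ} (hF : Summable F)
    {φ : κ × α → β} (hφ : Function.Bijective φ) :
    ∑' p, F p = ∑ i, ∑' a, F (φ (i, a)) := by
  have hs : Summable (F ∘ φ) := hF.comp_injective hφ.1
  rw [← (Equiv.ofBijective φ hφ).tsum_eq F, ← tsum_fintype (L := .unconditional κ)]
  exact hs.tsum_prod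

lemma summable_thetaSeries_mul {q z q' z' : ℂ} (hq0 : q ≠ 0) (hq : ‖q‖ < 1) (hz : z ≠ 0)
    (hq0' : q' ≠ 0) (hq' : ‖q'‖ < 1) (hz' : z' ≠ 0) :
    Summable fun p : ℤ × ℤ ↦ (z ^ p.1 * q ^ p.1 ^ 2) * (z' ^ p.2 * q' ^ p.2 ^ 2) :=
  summable_mul_of_summable_norm (f := fun n : ℤ ↦ z ^ n * q ^ n ^ 2)
    (g := fun n : ℤ ↦ z' ^ n * q' ^ n ^ 2) (summable_zpow_mul_zpow_sq hq0 hq hz).norm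
    (summable_zpow_mul_zpow_sq hq0' hq' hz').norm

lemma thetaSeries_mul_thetaSeries {q z q' z' : ℂ} (hq0 : q ≠ 0) (hq : ‖q‖ < 1) (hz : z ≠ 0)
    (hq0' : q' ≠ 0) (hq' : ‖q'‖ < 1) (hz' : z' ≠ 0) :
    thetaSeries z q * thetaSeries z' q' =
      ∑' p : ℤ × ℤ, (z ^ p.1 * q ^ p.1 ^ 2) * (z' ^ p.2 * q' ^ p.2 ^ 2) :=
  tsum_mul_tsum_of_summable_norm (summable_zpow_mul_zpow_sq hq0 hq hz).norm
    (summable_zpow_mul_zpow_sq hq0' hq' hz').norm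

lemma neg_zpow_sq {y : ℂ} (n : ℤ) : (-y) ^ n ^ 2 = (-1) ^ n * y ^ n ^ 2 := by
  rcases n.even_or_odd with h | h
  · rw [h.neg_one_zpow, Even.neg_zpow (by simp [Int.even_pow, h]), one_mul]
  · rw [h.neg_one_zpow, Odd.neg_zpow (by simp [Int.odd_pow, h]), neg_one_mul]

/-- Separating even and odd indices in `∑ y^{n²}`. -/
lemma thetaSeries_one_dissection {y : ℂ} (hy0 : y ≠ 0) (hy : ‖y‖ < 1) :
    thetaSeries 1 y = thetaSeries 1 (y ^ 4) + y * thetaSeries (y ^ 4) (y ^ 4) := by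
  have hφ : Function.Bijective fun p : Fin 2 × ℤ ↦ 2 * p.2 + ((p.1 : ℕ) : ℤ) := by
    constructor
    · rintro ⟨i, a⟩ ⟨j, b⟩ h
      simp only at h
      have := i.2; have := j.2
      ext <;> simp only <;> omega
    · intro n
      refine ⟨(⟨(n % 2).toNat, by omega⟩, n / 2), ?_⟩
      simp only
      omega
  rw [thetaSeries, tsum_eq_sum_tsum_of_bijective
    (summable_zpow_mul_zpow_sq hy0 hy one_ne_zero) hφ, Fin.sum_univ_two]
  congr 1
  · refine tsum_congr fun n ↦ ?_
    simp only [one_zpow, one_mul, Fin.val_zero, Nat.cast_zero, add_zero]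
    rw [← zpow_natCast y 4, ← zpow_mul]
    congr 1; push_cast; ring
  · rw [thetaSeries, ← tsum_mul_left]
    refine tsum_congr fun n ↦ ?_
    simp only [one_zpow, one_mul, Fin.val_one, Nat.cast_one]
    rw [← zpow_natCast y 4, ← zpow_mul, ← zpow_mul, ← zpow_add₀ hy0, ← zpow_one_add₀ hy0]
    congr 1; push_cast; ring

/-! ### The form `a² + 5b²` and classes modulo 6. -/

/-- The term `((-1)^b - (-1)^a) y^{a² + 5b²}`. -/
noncomputable def formTerm (y : ℂ) (p : ℤ × ℤ) : ℂ :=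
  ((-1) ^ p.2 - (-1) ^ p.1) * y ^ (p.1 ^ 2 + 5 * p.2 ^ 2)

lemma formTerm_eq {y : ℂ} (hy0 : y ≠ 0) (p : ℤ × ℤ) :
    formTerm y p = (1 ^ p.1 * y ^ p.1 ^ 2) * (1 ^ p.2 * (-y ^ 5) ^ p.2 ^ 2) -
      (1 ^ p.1 * (-y) ^ p.1 ^ 2) * (1 ^ p.2 * (y ^ 5) ^ p.2 ^ 2) := by
  rw [neg_zpow_sq, neg_zpow_sq, formTerm, ← zpow_natCast y 5, ← zpow_mul, zpow_add₀ hy0]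
  simp only [one_zpow]
  push_cast
  ring

lemma formTerm_of_even_add {y : ℂ} {a b : ℤ} (h : Even (a + b)) : formTerm y (a, b) = 0 := by
  have : (-1 : ℂ) ^ a = (-1) ^ b := by
    rcases b.even_or_odd with hb | hb
    · rw [hb.neg_one_zpow, ((Int.even_add.1 h).2 hb).neg_one_zpow]
    · rw [hb.neg_one_zpow, ((Int.even_add'.1 h).2 hb).neg_one_zpow]
  simp [formTerm, this]

lemma formTerm_of_odd_add {y : ℂ} {a b : ℤ} (h : Odd (a + b)) :
    formTerm y (a, b) = 2 * (-1) ^ b * y ^ (a ^ 2 + 5 * b ^ 2) := by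
  have : (-1 : ℂ) ^ a = -(-1) ^ b := by
    rcases b.even_or_odd with hb | hb
    · rw [hb.neg_one_zpow, ((Int.odd_add.1 h).2 hb).neg_one_zpow]
    · rw [hb.neg_one_zpow, ((Int.odd_add'.1 h).1 hb).neg_one_zpow, neg_neg]
  simp only [formTerm, this]
  ring

/-- The sublattice `6 ∣ a + b` has basis `(1, -1)`, `(5, 1)`, orthogonal for `a² + 5b²`. On each
class the exponent therefore has no cross term and the sum separates. -/
lemma bijective_six_classes : Function.Bijective
    fun p : Fin 6 × (ℤ × ℤ) ↦ (5 * p.2.2 + p.2.1 + ((p.1 : ℕ) : ℤ), p.2.2 - p.2.1) := by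
  constructor
  · rintro ⟨i, a, c⟩ ⟨j, b, d⟩ h
    simp only [Prod.mk.injEq] at h
    have := i.2; have := j.2
    ext <;> simp only <;> omega
  · rintro ⟨a, b⟩
    refine ⟨(⟨((a + b) % 6).toNat, by omega⟩, (a + b) / 6 - b, (a + b) / 6), ?_⟩
    simp only [Prod.mk.injEq]
    omega

lemma summable_formTerm {y : ℂ} (hy0 : y ≠ 0) (hy : ‖y‖ < 1) : Summable (formTerm y) := by
  have h5 : y ^ 5 ≠ 0 := pow_ne_zero 5 hy0
  have h5' := norm_pow_lt_one hy (show 5 ≠ 0 by norm_num)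
  rw [funext (formTerm_eq hy0)]
  exact (summable_thetaSeries_mul hy0 hy one_ne_zero (neg_ne_zero.2 h5) (by simpa using h5')
    one_ne_zero).sub (summable_thetaSeries_mul (neg_ne_zero.2 hy0) (by simpa using hy) one_ne_zero
    h5 h5' one_ne_zero)

lemma tsum_formTerm_eq {y : ℂ} (hy0 : y ≠ 0) (hy : ‖y‖ < 1) :
    ∑' p, formTerm y p = thetaSeries 1 y * thetaSeries 1 (-y ^ 5) -
      thetaSeries 1 (-y) * thetaSeries 1 (y ^ 5) := by
  have h5 : y ^ 5 ≠ 0 := pow_ne_zero 5 hy0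
  have h5' := norm_pow_lt_one hy (show 5 ≠ 0 by norm_num)
  have h5n : -y ^ 5 ≠ 0 := neg_ne_zero.2 h5
  have h5n' : ‖-y ^ 5‖ < 1 := by simpa using h5'
  have hyn : -y ≠ 0 := neg_ne_zero.2 hy0
  have hyn' : ‖-y‖ < 1 := by simpa using hy
  rw [thetaSeries_mul_thetaSeries hy0 hy one_ne_zero h5n h5n' one_ne_zero,
    thetaSeries_mul_thetaSeries hyn hyn' one_ne_zero h5 h5' one_ne_zero,
    ← (summable_thetaSeries_mul hy0 hy one_ne_zero h5n h5n' one_ne_zero).tsum_sub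
      (summable_thetaSeries_mul hyn hyn' one_ne_zero h5 h5' one_ne_zero)]
  exact tsum_congr (formTerm_eq hy0)

/-- The form equals `1 + 2(3m² + m) + 10(3n² + n)` here, with sign `(-1)^(m+n)`: a product of two
pentagonal number series. -/
lemma tsum_formTerm_class_one {x : ℂ} (hx0 : x ≠ 0) (hx : ‖x‖ < 1) :
    ∑' p : ℤ × ℤ, formTerm (x ^ 6) (5 * p.2 + p.1 + 1, p.2 - p.1) =
      2 * x ^ 6 * euler (x ^ 24) * euler (x ^ 120) := by
  have key := thetaSeries_mul_thetaSeries (q := (x ^ 12) ^ 3) (z := -x ^ 12) (q' := (x ^ 60) ^ 3)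
    (z' := - x ^ 60) (by positivity) (norm_pow_lt_one (norm_pow_lt_one hx (by norm_num))
      (by norm_num)) (by simpa using hx0) (by positivity)
      (norm_pow_lt_one (norm_pow_lt_one hx (by norm_num)) (by norm_num)) (by simpa using hx0)
  rw [thetaSeries_neg_cube (by positivity) (norm_pow_lt_one hx (by norm_num)),
    thetaSeries_neg_cube (by positivity) (norm_pow_lt_one hx (by norm_num)), ← pow_mul,
    ← pow_mul] at key
  rw [mul_assoc, key, ← tsum_mul_left]
  refine tsum_congr fun ⟨m, n⟩ ↦ ?_
  rw [formTerm_of_odd_add ⟨3 * n, by ring⟩, neg_eq_neg_one_mul (x ^ 12),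
    neg_eq_neg_one_mul (x ^ 60), mul_zpow, mul_zpow]
  have hsign : (-1 : ℂ) ^ (n - m) = (-1) ^ m * (-1) ^ n := by
    rw [← zpow_add₀ (by norm_num), show n - m = m + n + 2 * (-m) by ring,
      zpow_add₀ (by norm_num), zpow_mul]
    norm_num
  have hpow : (x ^ 6) ^ ((5 * n + m + 1) ^ 2 + 5 * (n - m) ^ 2) = x ^ 6 *
      (((x ^ 12) ^ m * ((x ^ 12) ^ 3) ^ m ^ 2) * ((x ^ 60) ^ n * ((x ^ 60) ^ 3) ^ n ^ 2)) := by
    simp only [← zpow_natCast, ← zpow_mul, ← zpow_add₀ hx0]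
    congr 1; push_cast; ring
  rw [hsign, hpow]
  ring

/-- `ψ(q²) φ(q⁵) - q φ(q) ψ(q¹⁰) = E(q) E(q⁵)`, with Ramanujan's theta functions `φ`, `ψ`. -/
lemma thetaSeries_weight_one_identity {q : ℂ} (hq0 : q ≠ 0) (hq : ‖q‖ < 1) :
    thetaSeries q q * thetaSeries 1 (q ^ 5) - q * thetaSeries 1 q * thetaSeries (q ^ 5) (q ^ 5) =
      2 * euler q * euler (q ^ 5) := by
  obtain ⟨x, rfl⟩ := IsAlgClosed.exists_pow_nat_eq q (show 0 < 24 by norm_num)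
  have hx0 : x ≠ 0 := by rintro rfl; simp at hq0
  have hx : ‖x‖ < 1 := by
    rw [norm_pow] at hq
    exact (pow_lt_one_iff_of_nonneg (norm_nonneg _) (by norm_num)).1 hq
  have hy0 : x ^ 6 ≠ 0 := pow_ne_zero 6 hx0
  have hy := norm_pow_lt_one hx (show 6 ≠ 0 by norm_num)
  have h30 : (x ^ 6) ^ 5 ≠ 0 := pow_ne_zero 5 hy0
  have h30' := norm_pow_lt_one hy (show 5 ≠ 0 by norm_num)
  -- Here `y = x⁶` satisfies `y⁴ = q`. Dissecting `φ(±y)` and `φ(±y⁵)` makes `φ(y) φ(-y⁵) - φ(-y)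
  -- φ(y⁵)` equal to `2y` times the left side.
  have d1 := thetaSeries_one_dissection hy0 hy
  have d2 := thetaSeries_one_dissection (neg_ne_zero.2 hy0) (by simpa using hy)
  have d3 := thetaSeries_one_dissection h30 h30'
  have d4 := thetaSeries_one_dissection (neg_ne_zero.2 h30) (by simpa using h30')
  rw [Even.neg_pow (by decide)] at d2 d4
  simp only [← pow_mul, Nat.reduceMul] at d1 d2 d3 d4
  have hL := tsum_formTerm_eq hy0 hy
  rw [tsum_eq_sum_tsum_of_bijective (summable_formTerm hy0 hy) bijective_six_classes,
    Fin.sum_univ_six] at hL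
  have c0 : ∑' p : ℤ × ℤ, formTerm (x ^ 6) (5 * p.2 + p.1 + ((0 : ℕ) : ℤ), p.2 - p.1) = 0 := by
    rw [← tsum_zero (α := ℂ) (β := ℤ × ℤ)]
    exact tsum_congr fun p ↦ formTerm_of_even_add ⟨3 * p.2, by push_cast; ring⟩
  have c2 : ∑' p : ℤ × ℤ, formTerm (x ^ 6) (5 * p.2 + p.1 + ((2 : ℕ) : ℤ), p.2 - p.1) = 0 := by
    rw [← tsum_zero (α := ℂ) (β := ℤ × ℤ)]
    exact tsum_congr fun p ↦ formTerm_of_even_add ⟨3 * p.2 + 1, by push_cast; ring⟩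
  have c4 : ∑' p : ℤ × ℤ, formTerm (x ^ 6) (5 * p.2 + p.1 + ((4 : ℕ) : ℤ), p.2 - p.1) = 0 := by
    rw [← tsum_zero (α := ℂ) (β := ℤ × ℤ)]
    exact tsum_congr fun p ↦ formTerm_of_even_add ⟨3 * p.2 + 2, by push_cast; ring⟩
  have c1 : ∑' p : ℤ × ℤ, formTerm (x ^ 6) (5 * p.2 + p.1 + ((1 : ℕ) : ℤ), p.2 - p.1) =
      2 * x ^ 6 * euler (x ^ 24) * euler (x ^ 120) := by
    simpa using tsum_formTerm_class_one hx0 hx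
  -- The map `(a, b) ↦ (-a, -b)` exchanges classes 1 and 5.
  have c5 : ∑' p : ℤ × ℤ, formTerm (x ^ 6) (5 * p.2 + p.1 + ((5 : ℕ) : ℤ), p.2 - p.1) =
      2 * x ^ 6 * euler (x ^ 24) * euler (x ^ 120) := by
    rw [← tsum_formTerm_class_one hx0 hx, ← ((Equiv.subLeft (-1 : ℤ)).prodCongr
      (Equiv.subLeft (-1 : ℤ))).tsum_eq]
    refine tsum_congr fun ⟨m, n⟩ ↦ ?_
    simp only [Equiv.prodCongr_apply, Prod.map_apply, Equiv.subLeft_apply]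
    rw [formTerm_of_odd_add ⟨-3 * n - 1, by push_cast; ring⟩, formTerm_of_odd_add ⟨3 * n, by ring⟩,
      show -1 - n - (-1 - m) = -(n - m) by ring, zpow_neg, ← inv_zpow, inv_neg, inv_one]
    congr 2
    push_cast; ring
  -- Under `n ↦ -1 - n` the exponent is fixed and the parity of `b` changes, so the sum equals its
  -- negative.
  have c3 : ∑' p : ℤ × ℤ, formTerm (x ^ 6) (5 * p.2 + p.1 + ((3 : ℕ) : ℤ), p.2 - p.1) = 0 := by
    rw [← self_eq_neg, ← tsum_neg, ← ((Equiv.refl ℤ).prodCongr (Equiv.subLeft (-1 : ℤ))).tsum_eq]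
    refine tsum_congr fun ⟨m, n⟩ ↦ ?_
    simp only [Equiv.prodCongr_apply, Prod.map_apply, Equiv.subLeft_apply, Equiv.refl_apply]
    rw [formTerm_of_odd_add ⟨-3 * n - 2, by push_cast; ring⟩,
      formTerm_of_odd_add ⟨3 * n + 1, by push_cast; ring⟩,
      show -1 - n - m = (n - m) + 2 * (-n) + (-1) by ring, zpow_add₀ (by norm_num),
      zpow_add₀ (by norm_num), zpow_mul]
    norm_num
    left
    congr 1
    ring
  simp only [Fin.isValue, Fin.coe_ofNat_eq_mod, Nat.reduceMod, Nat.zero_mod, Nat.one_mod] at hL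
  rw [c0, c1, c2, c3, c4, c5, ← pow_mul, d1, d2, d3, d4] at hL
  simp only [← pow_mul, Nat.reduceMul]
  refine mul_left_cancel₀ hy0 ?_
  linear_combination -hL / 2

/-! ### Sums of two odd squares and classes modulo 5. -/

lemma bijective_five_classes : Function.Bijective
    fun p : Fin 5 × (ℤ × ℤ) ↦ (p.2.2 + 2 * p.2.1 + ((p.1 : ℕ) : ℤ) - 1, 2 * p.2.2 - p.2.1) := by
  constructor
  · rintro ⟨i, a, c⟩ ⟨j, b, d⟩ h
    simp only [Prod.mk.injEq] at h
    have := i.2; have := j.2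
    ext <;> simp only <;> omega
  · rintro ⟨a, b⟩
    refine ⟨(⟨((a + 2 * b + 1) % 5).toNat, by omega⟩,
      2 * ((a + 2 * b + 1) / 5) - b, (a + 2 * b + 1) / 5), ?_⟩
    simp only [Prod.mk.injEq]
    omega

/-- Summing `x^{5(a² + b²)}` over odd `a`, `b` by the class of `a + 2b` modulo `5`. -/
lemma tsum_odd_squares {x : ℂ} (hs : Summable fun p : ℤ × ℤ ↦
      x ^ (5 * ((2 * p.1 + 1) ^ 2 + (2 * p.2 + 1) ^ 2))) :
    ∑' p : ℤ × ℤ, x ^ (5 * ((2 * p.1 + 1) ^ 2 + (2 * p.2 + 1) ^ 2)) =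
      4 * ∑' p : ℤ × ℤ, x ^ ((10 * p.1 + 3) ^ 2 + (10 * p.2 + 1) ^ 2) +
      ∑' p : ℤ × ℤ, x ^ (25 * ((2 * p.1 + 1) ^ 2 + (2 * p.2 + 1) ^ 2)) := by
  set S := ∑' p : ℤ × ℤ, x ^ ((10 * p.1 + 3) ^ 2 + (10 * p.2 + 1) ^ 2) with hS
  -- This is `5(U² + V²) = (2U - V)² + (U + 2V)²`. For `r = 2` both new squares are divisible by 25;
  -- the other four classes agree up to signs and order.
  have main (r : ℕ) : ∑' p : ℤ × ℤ, x ^ (5 * ((2 * (p.2 + 2 * p.1 + (r : ℤ) - 1) + 1) ^ 2 +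
      (2 * (2 * p.2 - p.1) + 1) ^ 2)) =
      ∑' p : ℤ × ℤ, x ^ ((10 * p.1 + 4 * (r : ℤ) - 3) ^ 2 + (10 * p.2 + 2 * (r : ℤ) + 1) ^ 2) :=
    tsum_congr fun p ↦ by congr 1; ring
  have c0 : ∑' p : ℤ × ℤ, x ^ ((10 * p.1 + 4 * ((0 : ℕ) : ℤ) - 3) ^ 2 +
      (10 * p.2 + 2 * ((0 : ℕ) : ℤ) + 1) ^ 2) = S := by
    rw [hS, ← ((Equiv.neg ℤ).prodCongr (Equiv.refl ℤ)).tsum_eq]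
    refine tsum_congr fun p ↦ ?_
    simp only [Equiv.prodCongr_apply, Prod.map, Equiv.neg_apply, Equiv.refl_apply]
    congr 1; push_cast; ring
  have c1 : ∑' p : ℤ × ℤ, x ^ ((10 * p.1 + 4 * ((1 : ℕ) : ℤ) - 3) ^ 2 +
      (10 * p.2 + 2 * ((1 : ℕ) : ℤ) + 1) ^ 2) = S := by
    rw [hS, ← (Equiv.prodComm ℤ ℤ).tsum_eq]
    refine tsum_congr fun p ↦ ?_
    simp only [Equiv.prodComm_apply, Prod.swap]
    congr 1; push_cast; ring
  have c2 : ∑' p : ℤ × ℤ, x ^ ((10 * p.1 + 4 * ((2 : ℕ) : ℤ) - 3) ^ 2 +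
      (10 * p.2 + 2 * ((2 : ℕ) : ℤ) + 1) ^ 2) =
      ∑' p : ℤ × ℤ, x ^ (25 * ((2 * p.1 + 1) ^ 2 + (2 * p.2 + 1) ^ 2)) :=
    tsum_congr fun p ↦ by congr 1; push_cast; ring
  have c3 : ∑' p : ℤ × ℤ, x ^ ((10 * p.1 + 4 * ((3 : ℕ) : ℤ) - 3) ^ 2 +
      (10 * p.2 + 2 * ((3 : ℕ) : ℤ) + 1) ^ 2) = S := by
    rw [hS, ← ((Equiv.prodComm ℤ ℤ).trans
      ((Equiv.subLeft (-1 : ℤ)).prodCongr (Equiv.subLeft (-1 : ℤ)))).tsum_eq]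
    refine tsum_congr fun p ↦ ?_
    simp only [Equiv.trans_apply, Equiv.prodComm_apply, Prod.swap, Equiv.prodCongr_apply, Prod.map,
      Equiv.subLeft_apply]
    congr 1; push_cast; ring
  have c4 : ∑' p : ℤ × ℤ, x ^ ((10 * p.1 + 4 * ((4 : ℕ) : ℤ) - 3) ^ 2 +
      (10 * p.2 + 2 * ((4 : ℕ) : ℤ) + 1) ^ 2) = S := by
    rw [hS, ← ((Equiv.subRight (1 : ℤ)).prodCongr (Equiv.subLeft (-1 : ℤ))).tsum_eq]
    refine tsum_congr fun p ↦ ?_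
    simp only [Equiv.prodCongr_apply, Prod.map, Equiv.subLeft_apply, Equiv.subRight_apply]
    congr 1; push_cast; ring
  rw [tsum_eq_sum_tsum_of_bijective hs bijective_five_classes, Fin.sum_univ_five]
  simp only [main]
  simp only [Fin.isValue, Fin.coe_ofNat_eq_mod, Nat.reduceMod, Nat.zero_mod, Nat.one_mod]
  rw [c0, c1, c2, c3, c4]
  ring

/-- `ψ²(q) - q ψ²(q⁵) = f(q, q⁴) f(q², q³)` for Ramanujan's theta function `ψ`,
in terms of Euler products. -/
lemma euler_level_ten_identity {q : ℂ} (hq0 : q ≠ 0) (hq : ‖q‖ < 1) :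
    euler (q ^ 2) ^ 4 / euler q ^ 2 - q * (euler (q ^ 10) ^ 4 / euler (q ^ 5) ^ 2) =
      euler (q ^ 2) * euler (q ^ 5) ^ 3 / (euler q * euler (q ^ 10)) := by
  -- Since `5(2a+1)² = 20(a² + a) + 5` and `∑ x^(20(a² + a)) = 2ψ(x⁴⁰)`, the choice is `q = x⁴⁰`.
  obtain ⟨x, rfl⟩ := IsAlgClosed.exists_pow_nat_eq q (show 0 < 40 by norm_num)
  have hx0 : x ≠ 0 := by rintro rfl; simp at hq0
  have hx : ‖x‖ < 1 := by
    rw [norm_pow] at hq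
    exact (pow_lt_one_iff_of_nonneg (norm_nonneg _) (by norm_num)).1 hq
  have h0 (k : ℕ) : x ^ k ≠ 0 := pow_ne_zero k hx0
  have h1 {k : ℕ} (hk : k ≠ 0) : ‖x ^ k‖ < 1 := norm_pow_lt_one hx hk
  have e1 (p : ℤ × ℤ) : x ^ (5 * ((2 * p.1 + 1) ^ 2 + (2 * p.2 + 1) ^ 2)) =
      x ^ 10 * (((x ^ 20) ^ p.1 * (x ^ 20) ^ p.1 ^ 2) * ((x ^ 20) ^ p.2 * (x ^ 20) ^ p.2 ^ 2)) := by
    simp only [← zpow_natCast, ← zpow_mul, ← zpow_add₀ hx0]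
    congr 1; push_cast; ring
  have e2 (p : ℤ × ℤ) : x ^ (25 * ((2 * p.1 + 1) ^ 2 + (2 * p.2 + 1) ^ 2)) =
      x ^ 50 * (((x ^ 100) ^ p.1 * (x ^ 100) ^ p.1 ^ 2) *
        ((x ^ 100) ^ p.2 * (x ^ 100) ^ p.2 ^ 2)) := by
    simp only [← zpow_natCast, ← zpow_mul, ← zpow_add₀ hx0]
    congr 1; push_cast; ring
  have e3 (p : ℤ × ℤ) : x ^ ((10 * p.1 + 3) ^ 2 + (10 * p.2 + 1) ^ 2) =
      x ^ 10 * (((x ^ 60) ^ p.1 * (x ^ 100) ^ p.1 ^ 2) *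
        ((x ^ 20) ^ p.2 * (x ^ 100) ^ p.2 ^ 2)) := by
    simp only [← zpow_natCast, ← zpow_mul, ← zpow_add₀ hx0]
    congr 1; push_cast; ring
  have s1 := summable_thetaSeries_mul (h0 20) (h1 (k := 20) (by norm_num)) (h0 20)
    (h0 20) (h1 (k := 20) (by norm_num)) (h0 20)
  have key := tsum_odd_squares (x := x) (by
    simp only [e1]
    exact s1.mul_left _)
  simp only [e1, e2, e3, tsum_mul_left] at key
  rw [← thetaSeries_mul_thetaSeries (h0 20) (h1 (by norm_num)) (h0 20) (h0 20) (h1 (by norm_num))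
    (h0 20), ← thetaSeries_mul_thetaSeries (h0 100) (h1 (by norm_num)) (h0 100) (h0 100)
    (h1 (by norm_num)) (h0 100), ← thetaSeries_mul_thetaSeries (h0 100) (h1 (by norm_num)) (h0 60)
    (h0 100) (h1 (by norm_num)) (h0 20), thetaSeries_self (h0 20) (h1 (by norm_num)),
    thetaSeries_self (h0 100) (h1 (by norm_num))] at key
  have five := thetaSeries_mul_thetaSeries_five (h0 20) (h1 (by norm_num))
  simp only [← pow_mul, Nat.reduceMul] at five key ⊢
  rw [five] at key
  refine mul_left_cancel₀ (h0 10) ?_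
  linear_combination key / 4

/-! ### From `q` to `-q`: the identities at level 20. -/

lemma euler_ne_zero_pow {q : ℂ} (hq : ‖q‖ < 1) {k : ℕ} (hk : k ≠ 0) : euler (q ^ k) ≠ 0 :=
  euler_ne_zero (norm_pow_lt_one hq hk)

lemma euler_neg {q : ℂ} (hq : ‖q‖ < 1) :
    euler (-q) = euler (q ^ 2) ^ 3 / (euler q * euler (q ^ 4)) := by
  have n1 := euler_ne_zero hq
  have n4 := euler_ne_zero_pow hq four_ne_zero
  rw [← euler_neg_mul hq]
  field_simp

lemma euler_neg_pow_five {q : ℂ} (hq : ‖q‖ < 1) :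
    euler (-q ^ 5) = euler (q ^ 10) ^ 3 / (euler (q ^ 5) * euler (q ^ 20)) := by
  have := euler_neg (norm_pow_lt_one hq (show 5 ≠ 0 by norm_num))
  simpa only [← pow_mul, Nat.reduceMul] using this

lemma euler_level_twenty_weight_one {q : ℂ} (hq0 : q ≠ 0) (hq : ‖q‖ < 1) :
    euler (q ^ 4) ^ 2 * euler (q ^ 5) ^ 2 + q * (euler q ^ 2 * euler (q ^ 20) ^ 2) =
      euler (q ^ 2) ^ 4 * euler (q ^ 10) ^ 4 /
        (euler q * euler (q ^ 4) * euler (q ^ 5) * euler (q ^ 20)) := by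
  have hn0 := neg_ne_zero.2 hq0
  have hn : ‖-q‖ < 1 := by simpa using hq
  have h := thetaSeries_weight_one_identity hn0 hn
  have h5 : (-q) ^ 5 = -q ^ 5 := Odd.neg_pow (by decide) q
  have hq5 := norm_pow_lt_one hq (show 5 ≠ 0 by norm_num)
  have n1 := euler_ne_zero hq
  have n (k : ℕ) (hk : k ≠ 0) := euler_ne_zero_pow hq hk
  have n2 := n 2 (by norm_num)
  have n4 := n 4 (by norm_num)
  have n5 := n 5 (by norm_num)
  have n10 := n 10 (by norm_num)
  have n20 := n 20 (by norm_num)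
  rw [h5, thetaSeries_self hn0 hn, thetaSeries_self (neg_ne_zero.2 (pow_ne_zero 5 hq0))
    (by simpa using hq5), thetaSeries_one hn0 hn, thetaSeries_one (neg_ne_zero.2
    (pow_ne_zero 5 hq0)) (by simpa using hq5), euler_neg hq, euler_neg_pow_five hq] at h
  simp only [neg_neg, Even.neg_pow (show Even 2 by decide), Even.neg_pow (show Even 4 by decide),
    ← pow_mul, Nat.reduceMul] at h
  field_simp at h ⊢
  linear_combination h

lemma euler_level_twenty_weight_one' {q : ℂ} (hq0 : q ≠ 0) (hq : ‖q‖ < 1) :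
    (euler q * euler (q ^ 4) / euler (q ^ 2)) ^ 2 +
      q * (euler (q ^ 5) * euler (q ^ 20) / euler (q ^ 10)) ^ 2 =
      euler q * euler (q ^ 4) * euler (q ^ 10) ^ 8 /
        (euler (q ^ 2) ^ 2 * (euler (q ^ 5) * euler (q ^ 20)) ^ 3) := by
  have h := euler_level_ten_identity (neg_ne_zero.2 hq0) (by simpa using hq)
  have n1 := euler_ne_zero hq
  have n (k : ℕ) (hk : k ≠ 0) := euler_ne_zero_pow hq hk
  have n2 := n 2 (by norm_num)
  have n4 := n 4 (by norm_num)
  have n5 := n 5 (by norm_num)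
  have n10 := n 10 (by norm_num)
  have n20 := n 20 (by norm_num)
  rw [Even.neg_pow (show Even 2 by decide), Even.neg_pow (show Even 10 by decide),
    Odd.neg_pow (show Odd 5 by decide), euler_neg hq, euler_neg_pow_five hq] at h
  field_simp at h ⊢
  linear_combination h

/-! ### Translation to eta functions. -/

/-- The root `e^{2πiτ/24}` of the nome. -/
noncomputable def nomeRoot (τ : ℍ) : ℂ := Function.Periodic.qParam 24 τ

lemma nomeRoot_ne_zero (τ : ℍ) : nomeRoot τ ≠ 0 := Complex.exp_ne_zero _

lemma nomeRoot_pow (τ : ℍ) : nomeRoot τ ^ 24 = nome τ := by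
  rw [nomeRoot, nome, Function.Periodic.qParam, ← Complex.exp_nat_mul]
  congr 1; push_cast; ring

lemma nome_ne_zero (τ : ℍ) : nome τ ≠ 0 := Complex.exp_ne_zero _

lemma norm_nome_lt_one (τ : ℍ) : ‖nome τ‖ < 1 := norm_exp_two_pi_I_lt_one τ

lemma etaScaled_eq (l : ℕ) (τ : ℍ) :
    etaScaled l τ = nomeRoot τ ^ l * euler (nome τ ^ l) := by
  rw [etaScaled, ModularForm.eta, nomeRoot, nome, euler]
  congr 1
  · simp only [Function.Periodic.qParam, ← Complex.exp_nat_mul]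
    congr 1; push_cast; ring
  · refine tprod_congr fun n ↦ ?_
    have h : Complex.exp (2 * Real.pi * Complex.I * (l * τ)) =
        Complex.exp (2 * Real.pi * Complex.I * τ) ^ l := by
      rw [← Complex.exp_nat_mul]; congr 1; ring
    rw [ModularForm.eta_q_eq_pow, h]

lemma etaScaled_ne_zero {l : ℕ} (hl : l ≠ 0) (τ : ℍ) : etaScaled l τ ≠ 0 := by
  rw [etaScaled_eq]
  exact mul_ne_zero (pow_ne_zero _ (nomeRoot_ne_zero τ)) (euler_ne_zero_pow (norm_nome_lt_one τ) hl)

lemma etaScaled_weight_two_identity (τ : ℍ) :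
    etaScaled 4 τ ^ 2 * etaScaled 5 τ ^ 2 + etaScaled 1 τ ^ 2 * etaScaled 20 τ ^ 2 =
      etaScaled 2 τ ^ 4 * etaScaled 10 τ ^ 4 /
        (etaScaled 1 τ * etaScaled 4 τ * etaScaled 5 τ * etaScaled 20 τ) := by
  have h := euler_level_twenty_weight_one (nome_ne_zero τ) (norm_nome_lt_one τ)
  have ht := nomeRoot_ne_zero τ
  simp only [etaScaled_eq, pow_one]
  -- The leading exponents are `2·4 + 2·5 = 18` and `2·1 + 2·20 = 18 + 24`, whence the extra factor
  -- `q`.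
  trans nomeRoot τ ^ 18 * (euler (nome τ ^ 4) ^ 2 * euler (nome τ ^ 5) ^ 2 +
    nome τ * (euler (nome τ) ^ 2 * euler (nome τ ^ 20) ^ 2))
  · generalize euler (nome τ) = a
    rw [← nomeRoot_pow]; ring
  · rw [h]
    field_simp

lemma etaScaled_weight_one_identity (τ : ℍ) :
    (etaScaled 1 τ * etaScaled 4 τ / etaScaled 2 τ) ^ 2 +
      (etaScaled 5 τ * etaScaled 20 τ / etaScaled 10 τ) ^ 2 =
      etaScaled 1 τ * etaScaled 4 τ * etaScaled 10 τ ^ 8 /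
        (etaScaled 2 τ ^ 2 * (etaScaled 5 τ * etaScaled 20 τ) ^ 3) := by
  have h := euler_level_twenty_weight_one' (nome_ne_zero τ) (norm_nome_lt_one τ)
  have ht := nomeRoot_ne_zero τ
  simp only [etaScaled_eq, pow_one]
  trans nomeRoot τ ^ 6 * ((euler (nome τ) * euler (nome τ ^ 4) / euler (nome τ ^ 2)) ^ 2 +
    nome τ * (euler (nome τ ^ 5) * euler (nome τ ^ 20) / euler (nome τ ^ 10)) ^ 2)
  · have : nome τ * (euler (nome τ ^ 5) * euler (nome τ ^ 20) / euler (nome τ ^ 10)) ^ 2 =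
      nomeRoot τ ^ 24 * (euler (nome τ ^ 5) * euler (nome τ ^ 20) / euler (nome τ ^ 10)) ^ 2 := by
      rw [nomeRoot_pow]
    rw [this]
    field_simp
  · rw [h]
    field_simp

/-! ### The Fricke involution. -/

/-- The automorphy factor of `η` under `z ↦ -1/z`. -/
noncomputable def etaFactor (z : ℂ) : ℂ := (Complex.sqrt Complex.I)⁻¹ * Complex.sqrt z

lemma sqrt_sq' (z : ℂ) : Complex.sqrt z ^ 2 = z := by
  rw [Complex.sqrt, ← Complex.cpow_nat_mul]; simp

lemma etaFactor_sq (z : ℂ) : etaFactor z ^ 2 = z / Complex.I := by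
  rw [etaFactor, mul_pow, inv_pow, sqrt_sq', sqrt_sq', div_eq_inv_mul]

/-- A positive real factor does not move the argument, so no branch of the root is crossed. This
handles products such as `etaFactor (20τ) * etaFactor (5τ)`, which squares alone determine only up
to sign. -/
lemma etaFactor_four_mul {z : ℂ} (hz : z ≠ 0) : etaFactor (4 * z) = 2 * etaFactor z := by
  have h4 : Complex.log (4 * z) = 2 * Complex.log 2 + Complex.log z := by
    rw [show (4 : ℂ) = ((4 : ℝ) : ℂ) by norm_num, Complex.log_ofReal_mul (by norm_num) hz,
      show (4 : ℝ) = 2 ^ 2 by norm_num, Real.log_pow]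
    simp
  have h : Complex.sqrt (4 * z) = 2 * Complex.sqrt z := by
    rw [Complex.sqrt, Complex.sqrt, Complex.cpow_def_of_ne_zero (by simpa using hz),
      Complex.cpow_def_of_ne_zero hz, h4, add_mul, Complex.exp_add, mul_right_comm,
      mul_inv_cancel₀ two_ne_zero, one_mul, Complex.exp_log two_ne_zero]
  rw [etaFactor, etaFactor, h]; ring

/-- The Fricke involution `τ ↦ -1/(20τ)`. -/
noncomputable def fricke (τ : ℍ) : ℍ :=
  ⟨-1 / (20 * τ), by
    rw [neg_div, one_div, ← inv_neg]
    have : (((⟨20 * τ, by simpa using τ.im_pos⟩ : ℍ) : ℂ)) = 20 * τ := rfl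
    have h := (⟨20 * τ, by simpa using τ.im_pos⟩ : ℍ).im_inv_neg_coe_pos
    simpa [this] using h⟩

lemma etaScaled_fricke {l m : ℕ} (hlm : l * m = 20) (τ : ℍ) :
    etaScaled l (fricke τ) = etaFactor (m * τ) * etaScaled m τ := by
  have hl : (l : ℂ) ≠ 0 := by rintro h; norm_cast at h; simp [h] at hlm
  have hm0 : m ≠ 0 := by rintro rfl; simp at hlm
  have hm : (m : ℂ) ≠ 0 := by exact_mod_cast hm0
  have hτ := τ.ne_zero
  have h20 : (l : ℂ) * m = 20 := by exact_mod_cast hlm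
  have him : 0 < ((m : ℂ) * τ).im := by
    have := τ.im_pos
    have : (0 : ℝ) < m := by exact_mod_cast Nat.pos_of_ne_zero hm0
    simp only [Complex.mul_im, Complex.natCast_re, Complex.natCast_im, zero_mul, add_zero]
    positivity
  have key := ModularForm.eta_comp_eq_csqrt_I_inv him
  simp only [Function.comp_apply, Pi.smul_apply, Pi.mul_apply, smul_eq_mul] at key
  have hf : (l : ℂ) * (fricke τ : ℂ) = -1 / (m * τ) := by
    change (l : ℂ) * (-1 / (20 * τ)) = _
    rw [← h20]; field_simp
  rw [etaScaled, hf, key, etaScaled, etaFactor]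
  ring

/-- The involution swaps the indices 1 and 20, 4 and 5, 2 and 10. With `c = τ/i`, the two left terms
acquire factors `10c` and `2c` and the right side `2c`; dividing by `2c` leaves the 5. -/
lemma etaScaled_weight_one_identity' (τ : ℍ) :
    (etaScaled 1 τ * etaScaled 4 τ / etaScaled 2 τ) ^ 2 +
      5 * (etaScaled 5 τ * etaScaled 20 τ / etaScaled 10 τ) ^ 2 =
      etaScaled 5 τ * etaScaled 20 τ * etaScaled 2 τ ^ 8 /
        (etaScaled 10 τ ^ 2 * (etaScaled 1 τ * etaScaled 4 τ) ^ 3) := by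
  have h := etaScaled_weight_one_identity (fricke τ)
  have hτ := τ.ne_zero
  have n1 := etaScaled_ne_zero one_ne_zero τ
  have n2 := etaScaled_ne_zero two_ne_zero τ
  have n4 := etaScaled_ne_zero four_ne_zero τ
  have n5 := etaScaled_ne_zero (show 5 ≠ 0 by norm_num) τ
  have n10 := etaScaled_ne_zero (show 10 ≠ 0 by norm_num) τ
  have n20 := etaScaled_ne_zero (show 20 ≠ 0 by norm_num) τ
  rw [etaScaled_fricke (l := 1) (m := 20) (by norm_num),
    etaScaled_fricke (l := 4) (m := 5) (by norm_num),
    etaScaled_fricke (l := 2) (m := 10) (by norm_num),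
    etaScaled_fricke (l := 5) (m := 4) (by norm_num),
    etaScaled_fricke (l := 20) (m := 1) (by norm_num),
    etaScaled_fricke (l := 10) (m := 2) (by norm_num)] at h
  have f20 : etaFactor ((20 : ℕ) * τ) = 2 * etaFactor (5 * τ) := by
    rw [← etaFactor_four_mul (by simpa using hτ)]; congr 1; push_cast; ring
  have f4 : etaFactor ((4 : ℕ) * τ) = 2 * etaFactor τ := by
    rw [← etaFactor_four_mul hτ]; norm_cast
  have s1 := etaFactor_sq τ
  have s2 := etaFactor_sq (2 * τ)
  have s5 := etaFactor_sq (5 * τ)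
  have s10 := etaFactor_sq (10 * τ)
  rw [f20, f4] at h
  simp only [Nat.cast_ofNat, Nat.cast_one, one_mul] at h
  set c : ℂ := τ / Complex.I with hc
  have hc0 : c ≠ 0 := div_ne_zero hτ Complex.I_ne_zero
  rw [mul_div_assoc, ← hc] at s2 s5 s10
  have hs1 : etaFactor τ ≠ 0 := by intro h0; rw [h0] at s1; simp at s1; exact hc0 s1.symm
  have l1 : (2 * etaFactor (5 * τ) * etaScaled 20 τ * (etaFactor (5 * τ) * etaScaled 5 τ) /
      (etaFactor (10 * τ) * etaScaled 10 τ)) ^ 2 =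
      10 * c * (etaScaled 5 τ * etaScaled 20 τ / etaScaled 10 τ) ^ 2 := by
    rw [div_pow, mul_pow (etaFactor _) (etaScaled 10 τ), s10]
    trans 4 * (etaFactor (5 * τ) ^ 2) ^ 2 * (etaScaled 20 τ * etaScaled 5 τ) ^ 2 /
      (10 * c * etaScaled 10 τ ^ 2)
    · ring
    · rw [s5]; field_simp; ring
  have l2 : (2 * etaFactor τ * etaScaled 4 τ * (etaFactor τ * etaScaled 1 τ) /
      (etaFactor (2 * τ) * etaScaled 2 τ)) ^ 2 =
      2 * c * (etaScaled 1 τ * etaScaled 4 τ / etaScaled 2 τ) ^ 2 := by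
    rw [div_pow, mul_pow (etaFactor _) (etaScaled 2 τ), s2]
    trans 4 * (etaFactor τ ^ 2) ^ 2 * (etaScaled 4 τ * etaScaled 1 τ) ^ 2 /
      (2 * c * etaScaled 2 τ ^ 2)
    · ring
    · rw [s1]; field_simp; ring
  have l3 : 2 * etaFactor (5 * τ) * etaScaled 20 τ * (etaFactor (5 * τ) * etaScaled 5 τ) *
      (etaFactor (2 * τ) * etaScaled 2 τ) ^ 8 / ((etaFactor (10 * τ) * etaScaled 10 τ) ^ 2 *
      (2 * etaFactor τ * etaScaled 4 τ * (etaFactor τ * etaScaled 1 τ)) ^ 3) =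
      2 * c * (etaScaled 5 τ * etaScaled 20 τ * etaScaled 2 τ ^ 8 /
        (etaScaled 10 τ ^ 2 * (etaScaled 1 τ * etaScaled 4 τ) ^ 3)) := by
    trans 2 * (etaFactor (5 * τ) ^ 2) * (etaFactor (2 * τ) ^ 2) ^ 4 * (etaScaled 5 τ *
      etaScaled 20 τ * etaScaled 2 τ ^ 8) / (etaFactor (10 * τ) ^ 2 * 8 * (etaFactor τ ^ 2) ^ 3 *
      (etaScaled 10 τ ^ 2 * (etaScaled 1 τ * etaScaled 4 τ) ^ 3))
    · ring
    · rw [s1, s2, s5, s10]; field_simp; ring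
  rw [l1, l2, l3] at h
  refine mul_left_cancel₀ (mul_ne_zero two_ne_zero hc0) ?_
  linear_combination h

lemma Z_eq (τ : ℍ) : Z τ = (etaScaled 2 τ ^ 5 * etaScaled 10 τ ^ 5 /
    ((etaScaled 1 τ * etaScaled 4 τ) ^ 2 * (etaScaled 5 τ * etaScaled 20 τ) ^ 2)) ^ 2 := by
  have hq0 := nome_ne_zero τ
  have hq := norm_nome_lt_one τ
  have ht := nomeRoot_ne_zero τ
  have n1 := euler_ne_zero hq
  have n (k : ℕ) (hk : k ≠ 0) := euler_ne_zero_pow hq hk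
  have n2 := n 2 (by norm_num)
  have n4 := n 4 (by norm_num)
  have n5 := n 5 (by norm_num)
  have n10 := n 10 (by norm_num)
  have n20 := n 20 (by norm_num)
  have h : ∑' m : ℤ, ∑' n : ℤ, nome τ ^ (m ^ 2 + 5 * n ^ 2) =
      thetaSeries 1 (nome τ) * thetaSeries 1 (nome τ ^ 5) := by
    have hterm (m n : ℤ) : nome τ ^ (m ^ 2 + 5 * n ^ 2) =
        nome τ ^ m ^ 2 * (nome τ ^ 5) ^ n ^ 2 := by
      rw [zpow_add₀ hq0, zpow_mul]
      norm_cast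
    simp only [thetaSeries, one_zpow, one_mul, hterm, tsum_mul_left, tsum_mul_right]
  rw [Z, h, thetaSeries_one hq0 hq, thetaSeries_one (pow_ne_zero 5 hq0)
    (norm_pow_lt_one hq (by norm_num)), euler_neg hq, euler_neg_pow_five hq]
  simp only [etaScaled_eq, pow_one, ← pow_mul (nome τ), Nat.reduceMul]
  field_simp

end LevelTwenty

theorem mainTheorem4 (τ : UpperHalfPlane) :
    LevelTwenty.Z τ ≠ 0 ∧ 1 + LevelTwenty.u τ ≠ 0 ∧
    (1 + LevelTwenty.v τ) * (1 + 5 * LevelTwenty.v τ) ≠ 0 ∧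
    LevelTwenty.X τ = LevelTwenty.u τ / (1 + LevelTwenty.u τ) ^ 2 ∧
    LevelTwenty.X τ =
      LevelTwenty.v τ / ((1 + LevelTwenty.v τ) * (1 + 5 * LevelTwenty.v τ)) := by
  open LevelTwenty in
  have n1 := etaScaled_ne_zero one_ne_zero τ
  have n2 := etaScaled_ne_zero two_ne_zero τ
  have n4 := etaScaled_ne_zero four_ne_zero τ
  have n5 := etaScaled_ne_zero (show 5 ≠ 0 by norm_num) τ
  have n10 := etaScaled_ne_zero (show 10 ≠ 0 by norm_num) τ
  have n20 := etaScaled_ne_zero (show 20 ≠ 0 by norm_num) τ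
  have hB := etaScaled_weight_two_identity τ
  have hA := etaScaled_weight_one_identity τ
  have hA' := etaScaled_weight_one_identity' τ
  have hZ := Z_eq τ
  simp only [X, z, u, v, hZ]
  generalize etaScaled 1 τ = e1 at *
  generalize etaScaled 2 τ = e2 at *
  generalize etaScaled 4 τ = e4 at *
  generalize etaScaled 5 τ = e5 at *
  generalize etaScaled 10 τ = e10 at *
  generalize etaScaled 20 τ = e20 at *
  have hu : 1 + (e1 * e20 / (e4 * e5)) ^ 2 =
      e2 ^ 4 * e10 ^ 4 / (e1 * e4 * e5 * e20) / (e4 * e5) ^ 2 := by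
    rw [← hB]; field_simp
  -- `v` is the ratio of the second to the first term on the left of `hA`.
  have hv : 1 + (e2 * e5 * e20 / (e1 * e4 * e10)) ^ 2 =
      e1 * e4 * e10 ^ 8 / (e2 ^ 2 * (e5 * e20) ^ 3) * (e2 / (e1 * e4)) ^ 2 := by
    rw [← hA]; field_simp
  have hv' : 1 + 5 * (e2 * e5 * e20 / (e1 * e4 * e10)) ^ 2 =
      e5 * e20 * e2 ^ 8 / (e10 ^ 2 * (e1 * e4) ^ 3) * (e2 / (e1 * e4)) ^ 2 := by
    rw [← hA']; field_simp
  rw [hu, hv, hv']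
  refine ⟨by positivity, by positivity, by positivity, ?_, ?_⟩
  · field_simp
  · field_simp
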